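/- Let $L\ge 2$ and $N\ge 0$ be integers, and index the coordinates of vectors in $\mathbb{R}^L$ by $\mathbb{Z}_L$. For $l\in\mathbb{Z}_L$ let $R_l$ be the cyclic shift $(R_lx)_k=x_{k-l}$ on $\mathbb{R}^L$. Let $x\in\mathbb{R}^L$, $\sigma\ge 0$ and $\ell_1,\dots,\ell_N\in\mathbb{Z}_L$, and observe $$y_i=R_{\ell_i}x+\xi_i,\qquad \xi_1,\dots,\xi_N\sim\mathcal N(0,\sigma^2I_L)\ \text{i.i.d.}$$ Let $C\in\mathbb{R}^{NL\times NL}$ be the matrix with entries $C_{ik;jl}=\langle R_{-k}y_i,R_{-l}y_j\rangle$ ($1\le i,j\le N$; $k,l\in\mathbb{Z}_L$), and consider the semidefinite program of maximizing $\operatorname{tr}(CV)$ over all real symmetric $V\in\mathbb{R}^{NL\times NL}$ with $$\sum_{k,l}V_{ik;jl}=1\ \text{ for all } i,j,\qquad V_{ik;il}=0\ \text{ for all } i \text{ and } k\ne l,\qquad V\ge 0\ \text{ entrywise},\qquad V\succeq 0.$$ For a feasible $V$ put $D_{ij}=1-\sum_{k\in\mathbb{Z}_L}V_{i,\ell_i+k;\,j,\ell_j+k}$,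 that is, the mass of the $(i,j)$ block of $V$ outside the positions $(k,l)$ with $k-l=\ell_i-\ell_j$, which are those that agree with the true shifts. Let $$\Delta=\min_{l\in\mathbb{Z}_L,\ l\ne 0}\bigl(\|x\|^2-\langle x,R_lx\rangle\bigr)$$ and assume that $\Delta>0$. Then, with probability at least $1-e^{-N+o(N)}$, the semidefinite program has a solution, and every solution $V$ of it satisfies $$\sum_{i,j=1}^N D_{ij}\ \le\ \frac{12\log(eL)\,\sigma\bigl(\|x\|+\sigma\sqrt L\bigr)}{\Delta}\,N^2 .$$ Here $o(N)$ denotes a function of $N$ alone, the same for all $L$, $x$, $\sigma$ and $\ell_1,\dots,\ell_N$. -/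

import Mathlib

open MeasureTheory ProbabilityTheory Filter Asymptotics
open scoped NNReal ENNReal BigOperators

noncomputable section

namespace MultirefAlign

/-- Real signals of length `L`, indexed cyclically by `ℤ/L`, with the Euclidean norm. -/
abbrev Signal (L : ℕ) [NeZero L] : Type := EuclideanSpace ℝ (ZMod L)

/-- The cyclic shift `R_l`, given by `(R_l x)_k = x_{k - l}`. -/
def shift {L : ℕ} [NeZero L] (l : ZMod L) (x : Signal L) : Signal L :=
  WithLp.toLp 2 fun k => x (k - l)

/-- The vectors `ξ_1, …, ξ_N` are i.i.d. with law `N(0, σ² I_L)`: their `N L` coordinates are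
independent real Gaussians with mean `0` and variance `σ²`. -/
structure IsWhiteNoise {L : ℕ} [NeZero L] {N : ℕ} {Ω : Type*} [MeasurableSpace Ω]
    (P : Measure Ω) (σ : ℝ≥0) (ξ : Fin N → Ω → Signal L) : Prop where
  indep : iIndepFun (fun (p : Fin N × ZMod L) (ω : Ω) => ξ p.1 ω p.2) P
  law : ∀ (i : Fin N) (k : ZMod L), HasLaw (fun ω => ξ i ω k) (gaussianReal 0 (σ ^ 2)) P

/-- The observations `y_i = R_{ℓ_i} x + ξ_i`. -/
def observation {L : ℕ} [NeZero L] {N : ℕ} (x : Signal L) (ℓ : Fin N → ZMod L)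
    (ξ : Fin N → Signal L) (i : Fin N) : Signal L :=
  shift (ℓ i) x + ξ i

/-- Real `N L × N L` matrices, with rows and columns indexed by pairs `(i, k)`. -/
abbrev BlockMatrix (N L : ℕ) : Type := Matrix (Fin N × ZMod L) (Fin N × ZMod L) ℝ

/-- The data Gram matrix `C_{ik;jl} = ⟨R_{-k} y_i, R_{-l} y_j⟩`. -/
def gramMatrix {L : ℕ} [NeZero L] {N : ℕ} (y : Fin N → Signal L) : BlockMatrix N L :=
  Matrix.of fun p q => inner ℝ (shift (-p.2) (y p.1)) (shift (-q.2) (y q.1))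

/-- The constraints of the semidefinite program. -/
structure IsFeasible {L : ℕ} [NeZero L] {N : ℕ} (V : BlockMatrix N L) : Prop where
  sum_eq_one : ∀ i j : Fin N, ∑ k : ZMod L, ∑ l : ZMod L, V (i, k) (j, l) = 1
  diag_block : ∀ (i : Fin N) (k l : ZMod L), k ≠ l → V (i, k) (i, l) = 0
  nonneg : ∀ p q : Fin N × ZMod L, 0 ≤ V p q
  posSemidef : V.PosSemidef

/-- `V` is a solution of the semidefinite program: it maximizes `tr (C V)` over all feasible
matrices, where `C` is the data Gram matrix of `y`. -/
structure IsSDPSolution {L : ℕ} [NeZero L] {N : ℕ} (y : Fin N → Signal L)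
    (V : BlockMatrix N L) : Prop where
  feasible : IsFeasible V
  optimal : ∀ W : BlockMatrix N L, IsFeasible W →
    (gramMatrix y * W).trace ≤ (gramMatrix y * V).trace

/-- `D_{ij} = 1 - ∑_k V_{i,ℓ_i+k; j,ℓ_j+k}`: the mass that the `(i,j)` block of `V`, whose entries
are nonnegative and sum to `1`, puts outside the positions `(k, l)` with `k - l = ℓ_i - ℓ_j` that
agree with the true shifts. -/
def deviation {L : ℕ} [NeZero L] {N : ℕ} (ℓ : Fin N → ZMod L) (V : BlockMatrix N L)
    (i j : Fin N) : ℝ :=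
  1 - ∑ k : ZMod L, V (i, ℓ i + k) (j, ℓ j + k)

/-- The gap `Δ = min_{l ≠ 0} (‖x‖² - ⟨x, R_l x⟩)` between the autocorrelation of the signal at
shift `0` and its largest autocorrelation at a nonzero shift (used for `L ≥ 2`). -/
def shiftGap {L : ℕ} [NeZero L] (x : Signal L) : ℝ :=
  ⨅ l : {l : ZMod L // l ≠ 0}, (‖x‖ ^ 2 - inner ℝ x (shift l.1 x))

end MultirefAlign

end

namespace MultirefAlign

/-! ### Deterministic analysis of the semidefinite program. -/

section Deterministic

variable {L : ℕ} [NeZero L] {N : ℕ}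

/-! An optimal `V` is compared with the feasible matrix `planted ℓ`. Without noise, an aligned entry
of the Gram matrix is `‖x‖²` and any other is at most `‖x‖² - Δ`, so block `(i, j)` of `V` loses at
least `Δ * D_ij`. Noise moves its entries by at most `b i + b j + a i j`, uniform bounds on
signal-noise and noise-noise correlations over all shifts. Diagonal blocks contribute the same for
every feasible matrix. Optimality thus gives `Δ ∑ D_ij ≤ 4 N ∑ b_j + 2 ∑_{i ≠ j} a_ij`
(`IsSDPSolution.shiftGap_mul_sum_deviation_le`).

It remains to bound the two sums with exponential moments, each maximum over shifts being replaced
by the logarithm of a `coshSum`. The `b j` are independent, so their moments multiply. The `a i j`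
are not: the off-diagonal pairs are split into `2 N` families of disjoint pairs, within each of
which there is independence, and the families are averaged by convexity of `exp`
(`exp_sum_log_offDiag_le`). Each sum exceeds its threshold with probability at most `exp (-N)`. -/

lemma shift_apply (l : ZMod L) (x : Signal L) (k : ZMod L) : shift l x k = x (k - l) := rfl

lemma shift_add (l : ZMod L) (x y : Signal L) : shift l (x + y) = shift l x + shift l y := rfl

lemma shift_shift (l m : ZMod L) (x : Signal L) : shift l (shift m x) = shift (l + m) x := by
  ext k
  simp only [shift_apply]
  exact congrArg x.ofLp (by ring)

lemma inner_eq_sum (x y : Signal L) : inner ℝ x y = ∑ k, x k * y k := by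
  simp [PiLp.inner_apply, mul_comm]

lemma inner_shift_shift (l m : ZMod L) (x y : Signal L) :
    inner ℝ (shift l x) (shift m y) = inner ℝ (shift (l - m) x) y := by
  rw [inner_eq_sum, inner_eq_sum, ← Equiv.sum_comp (Equiv.addRight m)]
  refine Finset.sum_congr rfl fun k _ => ?_
  simp only [shift_apply, Equiv.coe_addRight, add_sub_cancel_right]
  exact congrArg (fun t => x.ofLp t * y.ofLp k) (by ring)

lemma inner_shift_self (l : ZMod L) (x : Signal L) :
    inner ℝ (shift l x) (shift l x) = ‖x‖ ^ 2 := by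
  rw [inner_shift_shift, sub_self, ← real_inner_self_eq_norm_sq]
  congr 1
  ext k
  simp [shift_apply]

lemma shiftGap_le (x : Signal L) {l : ZMod L} (hl : l ≠ 0) :
    shiftGap x ≤ ‖x‖ ^ 2 - inner ℝ x (shift l x) :=
  ciInf_le (f := fun l : {l : ZMod L // l ≠ 0} => ‖x‖ ^ 2 - inner ℝ x (shift l.1 x))
    (Set.finite_range _).bddBelow ⟨l, hl⟩

lemma norm_pos_of_shiftGap_pos {x : Signal L} (h : 0 < shiftGap x) : 0 < ‖x‖ := by
  rcases eq_or_ne x 0 with rfl | hx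
  · simp [shiftGap] at h
  · exact norm_pos_iff.2 hx

/-- The part of the objective coming from the `(i, j)` block. -/
noncomputable def blockObjective (y : Fin N → Signal L) (V : BlockMatrix N L) (i j : Fin N) : ℝ :=
  ∑ k, ∑ l, V (i, k) (j, l) * gramMatrix y (i, k) (j, l)

lemma trace_gramMatrix_mul (y : Fin N → Signal L) {V : BlockMatrix N L} (hV : V.IsHermitian) :
    (gramMatrix y * V).trace = ∑ i, ∑ j, blockObjective y V i j := by
  simp only [Matrix.trace, Matrix.diag, Matrix.mul_apply, Fintype.sum_prod_type, blockObjective]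
  refine Finset.sum_congr rfl fun i _ => ?_
  rw [Finset.sum_comm]
  refine Finset.sum_congr rfl fun j _ => Finset.sum_congr rfl fun k _ =>
    Finset.sum_congr rfl fun l _ => ?_
  have := hV.apply (i, k) (j, l)
  simp only [star_trivial] at this
  rw [this, mul_comm]

/-- The planted solution, which puts equal mass on all positions that agree with the shifts. -/
noncomputable def planted (ℓ : Fin N → ZMod L) : BlockMatrix N L :=
  Matrix.of fun p q => if p.2 - ℓ p.1 = q.2 - ℓ q.1 then (L : ℝ)⁻¹ else 0

omit [NeZero L] in
lemma planted_apply (ℓ : Fin N → ZMod L) (i j : Fin N) (k l : ZMod L) :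
    planted ℓ (i, k) (j, l) = if k - ℓ i = l - ℓ j then (L : ℝ)⁻¹ else 0 := rfl

lemma sum_sum_aligned (ℓ : Fin N → ZMod L) (i j : Fin N) (f : ZMod L → ZMod L → ℝ) :
    ∑ k, ∑ l, (if k - ℓ i = l - ℓ j then f k l else 0) = ∑ k, f (ℓ i + k) (ℓ j + k) := by
  rw [← Equiv.sum_comp (Equiv.addLeft (ℓ i))]
  refine Finset.sum_congr rfl fun k _ => ?_
  rw [← Equiv.sum_comp (Equiv.addLeft (ℓ j))]
  simp

lemma planted_posSemidef (ℓ : Fin N → ZMod L) : (planted ℓ).PosSemidef := by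
  let B : Matrix (Fin N × ZMod L) (ZMod L) ℝ :=
    Matrix.of fun p m => if p.2 - ℓ p.1 = m then 1 else 0
  -- Positive semidefiniteness is read off from a Gram factorization.
  have h : planted ℓ = (L : ℝ)⁻¹ • (B * B.conjTranspose) := by
    ext ⟨i, k⟩ ⟨j, l⟩
    simp [B, Matrix.mul_apply, planted_apply, eq_comm]
  rw [h]
  exact (Matrix.posSemidef_self_mul_conjTranspose B).smul (by positivity)

lemma planted_isFeasible (ℓ : Fin N → ZMod L) : IsFeasible (planted ℓ) where
  sum_eq_one i j := by
    simp only [planted_apply]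
    rw [sum_sum_aligned ℓ i j fun _ _ => (L : ℝ)⁻¹]
    simp [ZMod.card, NeZero.ne]
  diag_block i k l hkl := by simp [planted_apply, hkl]
  nonneg p q := by
    obtain ⟨i, k⟩ := p
    obtain ⟨j, l⟩ := q
    rw [planted_apply]
    positivity
  posSemidef := planted_posSemidef ℓ

lemma IsFeasible.le_one {V : BlockMatrix N L} (hV : IsFeasible V) (p q : Fin N × ZMod L) :
    V p q ≤ 1 := by
  obtain ⟨i, k⟩ := p
  obtain ⟨j, l⟩ := q
  rw [← hV.sum_eq_one i j]
  calc V (i, k) (j, l) ≤ ∑ l, V (i, k) (j, l) :=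
        Finset.single_le_sum (f := fun l => V (i, k) (j, l)) (fun _ _ => hV.nonneg _ _)
          (Finset.mem_univ l)
    _ ≤ _ := Finset.single_le_sum (f := fun k => ∑ l, V (i, k) (j, l))
          (fun _ _ => Finset.sum_nonneg fun _ _ => hV.nonneg _ _) (Finset.mem_univ k)

lemma isCompact_isFeasible : IsCompact {V : BlockMatrix N L | IsFeasible V} := by
  have hbox : IsCompact (Set.univ.pi fun _ => Set.univ.pi fun _ => Set.Icc 0 1 :
      Set (BlockMatrix N L)) :=
    isCompact_univ_pi fun _ => isCompact_univ_pi fun _ => isCompact_Icc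
  refine hbox.of_isClosed_subset ?_ fun V hV p _ q _ => ⟨hV.nonneg p q, hV.le_one p q⟩
  have h : {V : BlockMatrix N L | IsFeasible V} =
      {V | (∀ i j : Fin N, ∑ k : ZMod L, ∑ l : ZMod L, V (i, k) (j, l) = 1) ∧
        (∀ (i : Fin N) (k l : ZMod L), k ≠ l → V (i, k) (i, l) = 0) ∧
        (∀ p q, 0 ≤ V p q) ∧ V.conjTranspose = V ∧
        ∀ v : Fin N × ZMod L → ℝ, 0 ≤ dotProduct (star v) (V.mulVec v)} := by
    ext V
    refine ⟨fun h => ⟨h.1, h.2, h.3, h.4.isHermitian, h.4.dotProduct_mulVec_nonneg⟩,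
      fun ⟨h1, h2, h3, h4, h5⟩ => ⟨h1, h2, h3, .of_dotProduct_mulVec_nonneg h4 h5⟩⟩
  rw [h]
  simp only [Set.ofPred_and, Set.ofPred_forall]
  have hc (p q : Fin N × ZMod L) : Continuous fun V : BlockMatrix N L => V p q :=
    (continuous_apply q).comp (continuous_apply p)
  refine .inter ?_ (.inter ?_ (.inter ?_ (.inter ?_ ?_)))
  · exact isClosed_iInter fun i => isClosed_iInter fun j => isClosed_eq (by fun_prop) (by fun_prop)
  · exact isClosed_iInter fun i => isClosed_iInter fun k => isClosed_iInter fun l =>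
      isClosed_iInter fun _ => isClosed_eq (hc _ _) (by fun_prop)
  · exact isClosed_iInter fun p => isClosed_iInter fun q => isClosed_le (by fun_prop) (hc _ _)
  · exact isClosed_eq (by fun_prop) (by fun_prop)
  · exact isClosed_iInter fun v => isClosed_le (by fun_prop) (by fun_prop)

lemma exists_isSDPSolution (y : Fin N → Signal L) : ∃ V, IsSDPSolution y V := by
  obtain ⟨V, hV, hmax⟩ := isCompact_isFeasible.exists_isMaxOn
    ⟨planted 0, planted_isFeasible (0 : Fin N → ZMod L)⟩
    (f := fun V => (gramMatrix y * V).trace) (by fun_prop)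
  exact ⟨V, hV, fun W hW => hmax hW⟩

/-- The diagonal block is supported on `k = l`, and all these positions are aligned. -/
lemma IsFeasible.deviation_self {V : BlockMatrix N L} (hV : IsFeasible V) (ℓ : Fin N → ZMod L)
    (i : Fin N) : deviation ℓ V i i = 0 := by
  rw [deviation, ← hV.sum_eq_one i i, sub_eq_zero]
  refine Eq.trans ?_ (Equiv.sum_comp (Equiv.addLeft (ℓ i)) fun k => V (i, k) (i, k)).symm
  exact Finset.sum_congr rfl fun k _ =>
    Finset.sum_eq_single k (fun l _ hl => hV.diag_block i k l hl.symm) (by simp)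

/-- The value does not depend on `V`, so the terms `‖ξ i‖²`, typically of order `σ² L` and hence too
large for the final bound, cancel in the comparison. -/
lemma IsFeasible.blockObjective_self {V : BlockMatrix N L} (hV : IsFeasible V)
    (y : Fin N → Signal L) (i : Fin N) : blockObjective y V i i = ‖y i‖ ^ 2 := by
  rw [← one_mul (‖y i‖ ^ 2), ← hV.sum_eq_one i i, blockObjective, Finset.sum_mul]
  refine Finset.sum_congr rfl fun k _ => ?_
  rw [Finset.sum_mul]
  refine Finset.sum_congr rfl fun l _ => ?_
  rcases eq_or_ne k l with rfl | h
  · rw [gramMatrix, Matrix.of_apply, inner_shift_self]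
  · rw [hV.diag_block i k l h, zero_mul, zero_mul]

/-! ### Stability of solutions under bounded noise correlations. -/

section Perturbation

variable {x : Signal L} {ℓ : Fin N → ZMod L} {ξ : Fin N → Signal L}
  {b : Fin N → ℝ} {a : Fin N → Fin N → ℝ}

lemma abs_gramMatrix_sub_le (hb : ∀ j m, |inner ℝ (shift m x) (ξ j)| ≤ b j)
    (ha : ∀ i j m, |inner ℝ (shift m (ξ i)) (ξ j)| ≤ a i j) (i j : Fin N) (k l : ZMod L) :
    |gramMatrix (observation x ℓ ξ) (i, k) (j, l)
      - inner ℝ (shift (-k + ℓ i) x) (shift (-l + ℓ j) x)| ≤ b i + b j + a i j := by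
  have h1 := hb j (-k + ℓ i - -l)
  have h2 := hb i (-l + ℓ j - -k)
  have h3 := ha i j (-k - -l)
  rw [← inner_shift_shift, abs_le] at h1 h2 h3
  rw [gramMatrix, Matrix.of_apply]
  simp only [observation, shift_add, shift_shift, inner_add_left, inner_add_right]
  rw [real_inner_comm (shift (-l + ℓ j) x) (shift (-k) (ξ i))]
  rw [abs_le]
  constructor <;> linarith [h1.1, h1.2, h2.1, h2.2, h3.1, h3.2]

/-- The entries of a block are weights of total mass one; mass `D_ij` sits where the signal
correlation falls short of `‖x‖²` by at least the gap. -/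
lemma IsFeasible.blockObjective_le {V : BlockMatrix N L} (hV : IsFeasible V)
    (hb : ∀ j m, |inner ℝ (shift m x) (ξ j)| ≤ b j)
    (ha : ∀ i j m, |inner ℝ (shift m (ξ i)) (ξ j)| ≤ a i j) (i j : Fin N) :
    blockObjective (observation x ℓ ξ) V i j ≤
      ‖x‖ ^ 2 - shiftGap x * deviation ℓ V i j + (b i + b j + a i j) := by
  have key (k l : ZMod L) : V (i, k) (j, l) * gramMatrix (observation x ℓ ξ) (i, k) (j, l) ≤
      V (i, k) (j, l) * (‖x‖ ^ 2 - shiftGap x + (b i + b j + a i j))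
        + shiftGap x * if k - ℓ i = l - ℓ j then V (i, k) (j, l) else 0 := by
    have h := (abs_le.1 (abs_gramMatrix_sub_le (ℓ := ℓ) hb ha i j k l)).2
    have hnn := hV.nonneg (i, k) (j, l)
    split_ifs with hkl
    · have h0 : -l + ℓ j = -k + ℓ i := by linear_combination hkl
      rw [h0, inner_shift_self] at h
      nlinarith
    · have h0 : (-k + ℓ i) - (-l + ℓ j) ≠ 0 := fun h0 => hkl (by linear_combination -h0)
      have := shiftGap_le x h0
      rw [inner_shift_shift, real_inner_comm] at h
      rw [mul_zero, add_zero]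
      exact mul_le_mul_of_nonneg_left (by linarith) hnn
  calc _ ≤ ∑ k, ∑ l, (V (i, k) (j, l) * (‖x‖ ^ 2 - shiftGap x + (b i + b j + a i j))
        + shiftGap x * if k - ℓ i = l - ℓ j then V (i, k) (j, l) else 0) :=
        Finset.sum_le_sum fun k _ => Finset.sum_le_sum fun l _ => key k l
    _ = _ := by
        simp only [Finset.sum_add_distrib, ← Finset.sum_mul, ← Finset.mul_sum]
        rw [hV.sum_eq_one, sum_sum_aligned ℓ i j fun k l => V (i, k) (j, l), deviation]
        ring

lemma le_blockObjective_planted (hb : ∀ j m, |inner ℝ (shift m x) (ξ j)| ≤ b j)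
    (ha : ∀ i j m, |inner ℝ (shift m (ξ i)) (ξ j)| ≤ a i j) (i j : Fin N) :
    ‖x‖ ^ 2 - (b i + b j + a i j) ≤ blockObjective (observation x ℓ ξ) (planted ℓ) i j := by
  rw [← one_mul (‖x‖ ^ 2 - _), ← (planted_isFeasible ℓ).sum_eq_one i j, blockObjective,
    Finset.sum_mul]
  refine Finset.sum_le_sum fun k _ => ?_
  rw [Finset.sum_mul]
  refine Finset.sum_le_sum fun l _ => ?_
  have h := (abs_le.1 (abs_gramMatrix_sub_le (ℓ := ℓ) hb ha i j k l)).1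
  rw [planted_apply]
  split_ifs with hkl
  · have h0 : -l + ℓ j = -k + ℓ i := by linear_combination hkl
    rw [h0, inner_shift_self] at h
    exact mul_le_mul_of_nonneg_left (by linarith) (by positivity)
  · simp

/-- Uniform bounds on the correlations of the noise with the signal and with itself bound the
deviation of every solution from the true shifts. -/
theorem IsSDPSolution.shiftGap_mul_sum_deviation_le {V : BlockMatrix N L}
    (hV : IsSDPSolution (observation x ℓ ξ) V)
    (hb : ∀ j m, |inner ℝ (shift m x) (ξ j)| ≤ b j)
    (ha : ∀ i j m, |inner ℝ (shift m (ξ i)) (ξ j)| ≤ a i j) :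
    shiftGap x * ∑ i, ∑ j, deviation ℓ V i j ≤
      4 * N * ∑ j, b j + 2 * ∑ i, ∑ j, if i = j then 0 else a i j := by
  have hopt := hV.optimal _ (planted_isFeasible ℓ)
  rw [trace_gramMatrix_mul _ (planted_posSemidef ℓ).isHermitian,
    trace_gramMatrix_mul _ hV.feasible.posSemidef.isHermitian] at hopt
  have hb0 (j : Fin N) : 0 ≤ b j := (abs_nonneg _).trans (hb j 0)
  have key (i j : Fin N) : shiftGap x * deviation ℓ V i j
      + blockObjective (observation x ℓ ξ) V i j ≤
      blockObjective (observation x ℓ ξ) (planted ℓ) i j +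
        (2 * b i + 2 * b j + 2 * if i = j then 0 else a i j) := by
    -- On the diagonal both objectives agree and the deviation is zero; the nonnegative `b` terms
    -- are kept only for uniformity.
    split_ifs with hij
    · subst hij
      rw [hV.feasible.deviation_self, hV.feasible.blockObjective_self,
        (planted_isFeasible ℓ).blockObjective_self]
      linarith [hb0 i]
    · linarith [hV.feasible.blockObjective_le (ℓ := ℓ) hb ha i j,
        le_blockObjective_planted (ℓ := ℓ) hb ha i j]
  have hsum := Finset.sum_le_sum fun i (_ : i ∈ Finset.univ) =>
    Finset.sum_le_sum fun j (_ : j ∈ Finset.univ) => key i j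
  simp only [Finset.sum_add_distrib, ← Finset.mul_sum, Finset.sum_const, Finset.card_univ,
    Fintype.card_fin, nsmul_eq_mul] at hsum
  linarith

end Perturbation

end Deterministic

end MultirefAlign

namespace MultirefAlign

/-! ### Independence of disjoint coordinate blocks. -/

section Blocks

variable {ι α : Type*} [Fintype ι] {μ : ι → Measure ℝ} [∀ i, IsProbabilityMeasure (μ i)]

/-- Functions of disjoint blocks of coordinates are independent under a product measure. -/
lemma lintegral_pi_prod_of_disjoint (T : Finset α) (S : α → Finset ι)
    (hS : (T : Set α).PairwiseDisjoint S) (F : α → (ι → ℝ) → ℝ≥0∞)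
    (hF : ∀ a, Measurable (F a)) (hdep : ∀ a ∈ T, DependsOn (F a) (S a : Set ι)) :
    ∫⁻ z, ∏ a ∈ T, F a z ∂Measure.pi μ = ∏ a ∈ T, ∫⁻ z, F a z ∂Measure.pi μ := by
  classical
  have hind : iIndepFun (fun i (z : ι → ℝ) => z i) (Measure.pi μ) :=
    iIndepFun_pi (X := fun _ x => x) fun _ => aemeasurable_id
  -- Extension by zero turns a function depending only on `U` into a function of the restriction to
  -- `U`.
  let ext (U : Finset ι) (w : U → ℝ) (i : ι) : ℝ := if h : i ∈ U then w ⟨i, h⟩ else 0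
  have hext (U : Finset ι) : Measurable (ext U) := by
    refine measurable_pi_lambda _ fun i => ?_
    by_cases h : i ∈ U
    · simpa [ext, h] using measurable_pi_apply _
    · simp [ext, h]
  have hfac (U : Finset ι) (G : (ι → ℝ) → ℝ≥0∞) (hG : DependsOn G (U : Set ι)) :
      G = (fun w => G (ext U w)) ∘ fun z (i : U) => z i := by
    ext z
    refine hG fun i hi => ?_
    simp [ext, Finset.mem_coe.1 hi]
  induction T using Finset.cons_induction with
  | empty => simp
  | cons c T hc ih =>
    simp only [Finset.prod_cons]
    rw [← ih (hS.subset (by simp)) fun a ha => hdep a (by simp [ha])]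
    refine lintegral_mul_eq_lintegral_mul_lintegral_of_indepFun'' (hF c).aemeasurable
      (Finset.measurable_prod _ fun a _ => hF a).aemeasurable ?_
    rw [hfac (S c) (F c) (hdep c (by simp)), hfac (T.biUnion S) (fun z => ∏ a ∈ T, F a z)]
    · refine (hind.indepFun_finset (S c) (T.biUnion S) ?_ fun i => measurable_pi_apply i).comp
        ((hF c).comp (hext _)) ((Finset.measurable_prod _ fun a _ => hF a).comp (hext _))
      rw [Finset.disjoint_biUnion_right]
      intro a ha
      exact hS (by simp) (by simp [ha]) (by rintro rfl; exact hc ha)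
    · intro z w hzw
      refine Finset.prod_congr rfl fun a ha => hdep a (by simp [ha]) fun i hi => hzw i ?_
      simpa using ⟨a, ha, hi⟩

end Blocks

/-! ### Gaussian exponential moments. -/

section Gaussian

lemma lintegral_exp_mul_gaussianReal (v : ℝ≥0) (t : ℝ) :
    ∫⁻ x, ENNReal.ofReal (Real.exp (t * x)) ∂gaussianReal 0 v =
      ENNReal.ofReal (Real.exp (v * t ^ 2 / 2)) := by
  rw [← ofReal_integral_eq_lintegral_ofReal (integrable_exp_mul_gaussianReal t)
    (ae_of_all _ fun _ => (Real.exp_pos _).le)]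
  have := congrFun (mgf_fun_id_gaussianReal (μ := 0) (v := v)) t
  rw [mgf] at this
  rw [this, zero_mul, zero_add]

/-- The integrand times the density is an unnormalized Gaussian density of variance `v / (1 - 2vt)`.
-/
lemma lintegral_exp_sq_gaussianReal {v : ℝ≥0} (hv : v ≠ 0) {t : ℝ} (ht : 2 * v * t < 1) :
    ∫⁻ x, ENNReal.ofReal (Real.exp (t * x ^ 2)) ∂gaussianReal 0 v =
      ENNReal.ofReal ((√(1 - 2 * v * t))⁻¹) := by
  have hv' : (0 : ℝ) < v := by positivity
  have hb : 0 < (1 - 2 * v * t) / (2 * v) := div_pos (by linarith) (by positivity)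
  rw [gaussianReal_of_var_ne_zero _ hv, lintegral_withDensity_eq_lintegral_mul _
    (measurable_gaussianPDF 0 v) (by fun_prop)]
  have h (x : ℝ) : (gaussianPDF 0 v * fun x => ENNReal.ofReal (Real.exp (t * x ^ 2))) x =
      ENNReal.ofReal ((√(2 * Real.pi * v))⁻¹ *
        Real.exp (-((1 - 2 * v * t) / (2 * v)) * x ^ 2)) := by
    rw [Pi.mul_apply, gaussianPDF, gaussianPDFReal, ← ENNReal.ofReal_mul (by positivity), mul_assoc,
      ← Real.exp_add]
    congr 3
    field_simp
    ring
  simp_rw [h]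
  rw [← ofReal_integral_eq_lintegral_ofReal ((integrable_exp_neg_mul_sq hb).const_mul _)
    (ae_of_all _ fun _ => by positivity), integral_const_mul, integral_gaussian]
  congr 1
  rw [← Real.sqrt_inv, ← Real.sqrt_inv, ← Real.sqrt_mul (by positivity)]
  congr 1
  have : (1 - 2 * v * t) ≠ 0 := by linarith
  field_simp

end Gaussian

end MultirefAlign

namespace MultirefAlign

/-! ### Soft maxima and the Chernoff bound. -/

section CoshSum

variable {κ : Type*} [Fintype κ]

/-- A smooth upper bound for the exponential of the largest absolute value of a family. -/
noncomputable def coshSum (a : κ → ℝ) : ℝ := ∑ m, (Real.exp (a m) + Real.exp (-a m))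

lemma coshSum_pos [Nonempty κ] (a : κ → ℝ) : 0 < coshSum a :=
  Finset.sum_pos (fun _ _ => by positivity) Finset.univ_nonempty

lemma abs_le_log_coshSum (a : κ → ℝ) (m : κ) : |a m| ≤ Real.log (coshSum a) := by
  have h : Real.exp (a m) + Real.exp (-a m) ≤ coshSum a :=
    Finset.single_le_sum (f := fun m => Real.exp (a m) + Real.exp (-a m))
      (fun _ _ => by positivity) (Finset.mem_univ m)
  have h1 := Real.exp_pos (a m)
  have h2 := Real.exp_pos (-a m)
  rw [Real.le_log_iff_exp_le (by linarith)]
  rcases abs_cases (a m) with ⟨h0, -⟩ | ⟨h0, -⟩ <;> rw [h0] <;> linarith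

lemma lintegral_coshSum_le {Z : Type*} [MeasurableSpace Z] {μ : Measure Z} {a : Z → κ → ℝ}
    (ha : ∀ m, Measurable fun z => a z m) {A : ℝ} (hA : 0 ≤ A)
    (h : ∀ m, ∫⁻ z, ENNReal.ofReal (Real.exp (a z m)) ∂μ ≤ ENNReal.ofReal A)
    (h' : ∀ m, ∫⁻ z, ENNReal.ofReal (Real.exp (-a z m)) ∂μ ≤ ENNReal.ofReal A) :
    ∫⁻ z, ENNReal.ofReal (coshSum (a z)) ∂μ ≤ ENNReal.ofReal (2 * Fintype.card κ * A) := by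
  simp only [coshSum]
  simp_rw [ENNReal.ofReal_sum_of_nonneg fun m (_ : m ∈ Finset.univ) =>
    (add_pos (Real.exp_pos (a _ m)) (Real.exp_pos (-a _ m))).le,
    ENNReal.ofReal_add (Real.exp_pos _).le (Real.exp_pos _).le]
  rw [lintegral_finsetSum _ fun m _ => by have := ha m; fun_prop]
  calc _ ≤ ∑ m : κ, (ENNReal.ofReal A + ENNReal.ofReal A) := by
        refine Finset.sum_le_sum fun m _ => ?_
        rw [lintegral_add_left (by have := ha m; fun_prop)]
        exact add_le_add (h m) (h' m)
    _ = _ := by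
        rw [Finset.sum_const, Finset.card_univ, nsmul_eq_mul, ← ENNReal.ofReal_add hA hA,
          ← ENNReal.ofReal_natCast, ← ENNReal.ofReal_mul (by positivity)]
        congr 1
        ring

end CoshSum

lemma measure_ge_le_ofReal_mul_exp_neg {Z : Type*} [MeasurableSpace Z] {μ : Measure Z} {f : Z → ℝ}
    (hf : Measurable f) {A : ℝ} (h : ∫⁻ z, ENNReal.ofReal (Real.exp (f z)) ∂μ ≤ ENNReal.ofReal A)
    (t : ℝ) : μ {z | t ≤ f z} ≤ ENNReal.ofReal (A * Real.exp (-t)) := by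
  have hm := mul_meas_ge_le_lintegral (μ := μ) (f := fun z => ENNReal.ofReal (Real.exp (f z)))
    (by fun_prop) (ENNReal.ofReal (Real.exp t))
  have hset : {z | ENNReal.ofReal (Real.exp t) ≤ ENNReal.ofReal (Real.exp (f z))} =
      {z | t ≤ f z} := by
    ext z
    simp [ENNReal.ofReal_le_ofReal_iff (Real.exp_pos _).le]
  rw [hset] at hm
  calc μ {z | t ≤ f z}
      = ENNReal.ofReal (Real.exp (-t)) * (ENNReal.ofReal (Real.exp t) * μ {z | t ≤ f z}) := by
        rw [← mul_assoc, ← ENNReal.ofReal_mul (Real.exp_pos _).le, ← Real.exp_add]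
        simp
    _ ≤ ENNReal.ofReal (Real.exp (-t)) * ENNReal.ofReal A := by gcongr; exact hm.trans h
    _ = _ := by rw [← ENNReal.ofReal_mul (Real.exp_pos _).le, mul_comm]

/-! ### Exponential moments of the noise correlations. -/

section Noise

variable {L : ℕ} [NeZero L] {N : ℕ}

/-- The joint law of `N L` independent centred Gaussians of variance `v`. -/
noncomputable abbrev noiseLaw (N L : ℕ) [NeZero L] (v : ℝ≥0) : Measure (Fin N × ZMod L → ℝ) :=
  Measure.pi fun _ => gaussianReal 0 v

/-- The `i`-th noise signal assembled from its coordinates. -/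
def noiseSignal (z : Fin N × ZMod L → ℝ) (i : Fin N) : Signal L :=
  WithLp.toLp 2 fun k => z (i, k)

lemma inner_shift_noiseSignal (x : Signal L) (z : Fin N × ZMod L → ℝ) (j : Fin N) (m : ZMod L) :
    inner ℝ (shift m x) (noiseSignal z j) = ∑ k, x (k - m) * z (j, k) := by
  rw [inner_eq_sum]
  rfl

lemma inner_shift_noiseSignal_noiseSignal (z : Fin N × ZMod L → ℝ) (i j : Fin N) (m : ZMod L) :
    inner ℝ (shift m (noiseSignal z i)) (noiseSignal z j) = ∑ k, z (i, k - m) * z (j, k) :=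
  inner_shift_noiseSignal _ z j m

lemma lintegral_exp_mul_eval {v : ℝ≥0} (p : Fin N × ZMod L) (t : ℝ) :
    ∫⁻ z, ENNReal.ofReal (Real.exp (t * z p)) ∂noiseLaw N L v =
      ENNReal.ofReal (Real.exp (v * t ^ 2 / 2)) := by
  rw [← lintegral_exp_mul_gaussianReal]
  exact (measurePreserving_eval (fun _ : Fin N × ZMod L => gaussianReal 0 v) p).lintegral_comp
    (f := fun x => ENNReal.ofReal (Real.exp (t * x))) (by fun_prop)

/-- Integrating out one coordinate leaves the exponential of a multiple of the other one squared. -/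
lemma lintegral_exp_mul_eval_mul_eval {v : ℝ≥0} (hv : v ≠ 0) {p q : Fin N × ZMod L} (hpq : p ≠ q)
    {t : ℝ} (ht : (v : ℝ) ^ 2 * t ^ 2 < 1) :
    ∫⁻ z, ENNReal.ofReal (Real.exp (t * (z p * z q))) ∂noiseLaw N L v =
      ENNReal.ofReal ((√(1 - (v : ℝ) ^ 2 * t ^ 2))⁻¹) := by
  have hind : iIndepFun (fun i (z : Fin N × ZMod L → ℝ) => z i) (noiseLaw N L v) :=
    iIndepFun_pi (X := fun _ x => x) fun _ => aemeasurable_id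
  have hmap : (noiseLaw N L v).map (fun z => (z p, z q)) =
      (gaussianReal 0 v).prod (gaussianReal 0 v) := by
    rw [(indepFun_iff_map_prod_eq_prod_map_map (measurable_pi_apply p).aemeasurable
      (measurable_pi_apply q).aemeasurable).1 (hind.indepFun hpq)]
    exact congrArg₂ _ (measurePreserving_eval _ p).map_eq (measurePreserving_eval _ q).map_eq
  have hmeas : Measurable fun w : ℝ × ℝ => ENNReal.ofReal (Real.exp (t * (w.1 * w.2))) := by
    fun_prop
  rw [← lintegral_map (f := fun w : ℝ × ℝ => ENNReal.ofReal (Real.exp (t * (w.1 * w.2)))) hmeas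
    (g := fun z : Fin N × ZMod L → ℝ => (z p, z q)) (by fun_prop), hmap,
    lintegral_prod _ hmeas.aemeasurable]
  simp_rw [← mul_assoc t, lintegral_exp_mul_gaussianReal]
  have h2 : 2 * (v : ℝ) * (v * t ^ 2 / 2) = (v : ℝ) ^ 2 * t ^ 2 := by ring
  rw [← h2, ← lintegral_exp_sq_gaussianReal hv (h2 ▸ ht)]
  congr with x
  congr 2
  ring

lemma lintegral_exp_linear {v : ℝ≥0} (j : Fin N) (c : ZMod L → ℝ) :
    ∫⁻ z, ENNReal.ofReal (Real.exp (∑ k, c k * z (j, k))) ∂noiseLaw N L v =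
      ENNReal.ofReal (Real.exp (v * (∑ k, c k ^ 2) / 2)) := by
  simp_rw [Real.exp_sum, ENNReal.ofReal_prod_of_nonneg fun k (_ : k ∈ Finset.univ) =>
    (Real.exp_pos (c k * _)).le]
  rw [lintegral_pi_prod_of_disjoint Finset.univ (fun k => {(j, k)}) (by
      intro k _ l _ hkl
      simpa using hkl) (fun k z => ENNReal.ofReal (Real.exp (c k * z (j, k))))
    (fun k => by fun_prop) (by
      intro k _ z w hzw
      simp [hzw (j, k) (by simp)])]
  simp_rw [lintegral_exp_mul_eval]
  rw [← ENNReal.ofReal_prod_of_nonneg fun _ _ => (Real.exp_pos _).le, ← Real.exp_sum,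
    ← Finset.sum_div, ← Finset.mul_sum]

/-- Since `i ≠ j`, the `L` products use disjoint pairs of coordinates, so their moments multiply. -/
lemma lintegral_exp_bilinear {v : ℝ≥0} (hv : v ≠ 0) {i j : Fin N} (hij : i ≠ j) (m : ZMod L)
    {t : ℝ} (ht : (v : ℝ) ^ 2 * t ^ 2 < 1) :
    ∫⁻ z, ENNReal.ofReal (Real.exp (t * ∑ k, z (i, k - m) * z (j, k))) ∂noiseLaw N L v =
      ENNReal.ofReal ((√(1 - (v : ℝ) ^ 2 * t ^ 2))⁻¹ ^ L) := by
  simp_rw [Finset.mul_sum, Real.exp_sum, ENNReal.ofReal_prod_of_nonneg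
    fun k (_ : k ∈ Finset.univ) => (Real.exp_pos (t * _)).le]
  rw [lintegral_pi_prod_of_disjoint Finset.univ (fun k => {(i, k - m), (j, k)}) (by
      intro k _ l _ hkl
      simp [Function.onFun, hij, hij.symm, hkl.symm])
    (fun k z => ENNReal.ofReal (Real.exp (t * (z (i, k - m) * z (j, k)))))
    (fun k => by fun_prop) (by
      intro k _ z w hzw
      simp [hzw (j, k) (by simp), hzw (i, k - m) (by simp)])]
  simp_rw [fun k => lintegral_exp_mul_eval_mul_eval hv (p := (i, k - m)) (q := (j, k))
    (by simp [hij]) ht]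
  rw [Finset.prod_const, Finset.card_univ, ZMod.card, ENNReal.ofReal_pow (by positivity)]

/-- Exponential control of the correlations of the `j`-th noise signal with `x`. -/
noncomputable def crossSum (x : Signal L) (t : ℝ) (z : Fin N × ZMod L → ℝ) (j : Fin N) : ℝ :=
  coshSum fun m => t * inner ℝ (shift m x) (noiseSignal z j)

/-- Exponential control of the correlations of two noise signals. -/
noncomputable def noiseSum (t : ℝ) (z : Fin N × ZMod L → ℝ) (i j : Fin N) : ℝ :=
  coshSum fun m => t * inner ℝ (shift m (noiseSignal z i)) (noiseSignal z j)

lemma crossSum_pos (x : Signal L) (t : ℝ) (z : Fin N × ZMod L → ℝ) (j : Fin N) :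
    0 < crossSum x t z j := coshSum_pos _

lemma noiseSum_pos (t : ℝ) (z : Fin N × ZMod L → ℝ) (i j : Fin N) : 0 < noiseSum t z i j :=
  coshSum_pos _

@[fun_prop]
lemma measurable_crossSum (x : Signal L) (t : ℝ) (j : Fin N) :
    Measurable fun z : Fin N × ZMod L → ℝ => crossSum x t z j := by
  simp only [crossSum, coshSum, inner_shift_noiseSignal]
  fun_prop

@[fun_prop]
lemma measurable_noiseSum (t : ℝ) (i j : Fin N) :
    Measurable fun z : Fin N × ZMod L → ℝ => noiseSum t z i j := by
  simp only [noiseSum, coshSum, inner_shift_noiseSignal_noiseSignal]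
  fun_prop

lemma lintegral_crossSum_le {v : ℝ≥0} (x : Signal L) {t : ℝ} (ht : v * (t ^ 2 * ‖x‖ ^ 2) ≤ 1)
    (j : Fin N) :
    ∫⁻ z, ENNReal.ofReal (crossSum x t z j) ∂noiseLaw N L v ≤
      ENNReal.ofReal (2 * L * Real.exp (1 / 2)) := by
  have hmain (m : ZMod L) (s : ℝ) (hs : s ^ 2 = t ^ 2) :
      ∫⁻ z, ENNReal.ofReal (Real.exp (s * ∑ k, x (k - m) * z (j, k))) ∂noiseLaw N L v ≤
        ENNReal.ofReal (Real.exp (1 / 2)) := by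
    simp_rw [Finset.mul_sum, ← mul_assoc]
    rw [lintegral_exp_linear]
    gcongr
    have : ∑ k, (s * x (k - m)) ^ 2 = t ^ 2 * ‖x‖ ^ 2 := by
      rw [← inner_shift_self m x, inner_eq_sum, Finset.mul_sum]
      refine Finset.sum_congr rfl fun k _ => ?_
      rw [shift_apply, ← hs]
      ring
    rw [this]
    exact ht
  have h := lintegral_coshSum_le (μ := noiseLaw N L v)
    (a := fun z m => t * inner ℝ (shift m x) (noiseSignal z j)) (A := Real.exp (1 / 2))
    (fun m => by simp only [inner_shift_noiseSignal]; fun_prop) (Real.exp_pos _).le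
    (fun m => by simpa only [inner_shift_noiseSignal] using hmain m t rfl)
    (fun m => by
      simpa only [inner_shift_noiseSignal, neg_mul] using hmain m (-t) (by ring))
  rwa [ZMod.card] at h

-- With `r = √(1 - 1/L) ≥ 1/2`, the identity `L (1 - r) (1 + r) = 1` gives `L (1 - r) ≤ 2/3`, and
-- Bernoulli's inequality gives `r ^ L ≥ 1/3`.
omit [NeZero L] in
lemma inv_sqrt_one_sub_inv_pow_le (hL : 2 ≤ L) : (√(1 - (L : ℝ)⁻¹))⁻¹ ^ L ≤ 3 := by
  have hL' : (2 : ℝ) ≤ L := by exact_mod_cast hL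
  have hinv : (L : ℝ)⁻¹ ≤ 1 / 2 := by
    rw [one_div]
    exact inv_anti₀ (by norm_num) hL'
  set r := √(1 - (L : ℝ)⁻¹) with hr
  have hr2 : r ^ 2 = 1 - (L : ℝ)⁻¹ := Real.sq_sqrt (by linarith)
  have hr0 : 0 ≤ r := Real.sqrt_nonneg _
  have hr1 : 1 / 2 ≤ r := by nlinarith
  have hbern := one_add_mul_le_pow (a := r - 1) (by linarith) L
  rw [add_sub_cancel] at hbern
  have hLr : (L : ℝ) * (1 - r) * (1 + r) = 1 := by
    have : (L : ℝ) * (L : ℝ)⁻¹ = 1 := mul_inv_cancel₀ (by linarith)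
    linear_combination this - L * hr2
  have : (L : ℝ) * (1 - r) ≤ 2 / 3 := by
    have : r ≤ 1 := by
      have := inv_nonneg.2 (show (0 : ℝ) ≤ L by linarith)
      nlinarith
    have : 0 ≤ (L : ℝ) * (1 - r) := mul_nonneg (by linarith) (by linarith)
    nlinarith
  rw [inv_pow]
  exact inv_le_of_inv_le₀ (by norm_num) (by linarith)

lemma lintegral_noiseSum_le (hL : 2 ≤ L) {v : ℝ≥0} (hv : v ≠ 0) {t : ℝ}
    (ht : (v : ℝ) ^ 2 * t ^ 2 = (L : ℝ)⁻¹) {i j : Fin N} (hij : i ≠ j) :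
    ∫⁻ z, ENNReal.ofReal (noiseSum t z i j) ∂noiseLaw N L v ≤ ENNReal.ofReal (6 * L) := by
  have hmain (m : ZMod L) (s : ℝ) (hs : s ^ 2 = t ^ 2) :
      ∫⁻ z, ENNReal.ofReal (Real.exp (s * ∑ k, z (i, k - m) * z (j, k))) ∂noiseLaw N L v ≤
        ENNReal.ofReal 3 := by
    rw [← hs] at ht
    rw [lintegral_exp_bilinear hv hij m, ht]
    · exact ENNReal.ofReal_le_ofReal (inv_sqrt_one_sub_inv_pow_le hL)
    · rw [ht]
      exact inv_lt_one_of_one_lt₀ (by exact_mod_cast hL)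
  have h := lintegral_coshSum_le (μ := noiseLaw N L v)
    (a := fun z m => t * inner ℝ (shift m (noiseSignal z i)) (noiseSignal z j)) (A := 3)
    (fun m => by simp only [inner_shift_noiseSignal_noiseSignal]; fun_prop) (by norm_num)
    (fun m => by simpa only [inner_shift_noiseSignal_noiseSignal] using hmain m t rfl)
    (fun m => by
      simpa only [inner_shift_noiseSignal_noiseSignal, neg_mul] using hmain m (-t) (by ring))
  rw [ZMod.card, show 2 * (L : ℝ) * 3 = 6 * L by ring] at h
  exact h

lemma lintegral_prod_crossSum_le {v : ℝ≥0} (x : Signal L) {t : ℝ}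
    (ht : v * (t ^ 2 * ‖x‖ ^ 2) ≤ 1) :
    ∫⁻ z, ENNReal.ofReal (∏ j, crossSum x t z j) ∂noiseLaw N L v ≤
      ENNReal.ofReal ((2 * L * Real.exp (1 / 2)) ^ N) := by
  simp_rw [ENNReal.ofReal_prod_of_nonneg fun j (_ : j ∈ Finset.univ) => (crossSum_pos x t _ j).le]
  rw [lintegral_pi_prod_of_disjoint Finset.univ (fun j => {j} ×ˢ Finset.univ) (by
      intro i _ j _ hij
      exact Finset.disjoint_product.2 (.inl (by simpa using hij)))
    (fun j z => ENNReal.ofReal (crossSum x t z j)) (fun j => by fun_prop) (by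
      intro j _ z w hzw
      have h (k : ZMod L) : z (j, k) = w (j, k) := hzw _ (by simp)
      simp [crossSum, inner_shift_noiseSignal, h])]
  refine (Finset.prod_le_pow_card _ _ _ fun j _ => lintegral_crossSum_le x ht j).trans_eq ?_
  rw [Finset.card_univ, Fintype.card_fin, ENNReal.ofReal_pow (by positivity)]

/-- The hypotheses make the pairs `{i, π i}`, `i ∈ T`, disjoint, so the factors involve different
noise signals. -/
lemma lintegral_prod_noiseSum_le (hL : 2 ≤ L) {v : ℝ≥0} (hv : v ≠ 0) {t : ℝ}
    (ht : (v : ℝ) ^ 2 * t ^ 2 = (L : ℝ)⁻¹) (T : Finset (Fin N)) (π : Fin N → Fin N)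
    (hπ : ∀ i ∈ T, i ≠ π i)
    (hdisj : ∀ i ∈ T, ∀ j ∈ T, i ≠ j → i ≠ π j ∧ π i ≠ π j) :
    ∫⁻ z, ENNReal.ofReal (∏ i ∈ T, noiseSum t z i (π i)) ∂noiseLaw N L v ≤
      ENNReal.ofReal ((6 * L) ^ N) := by
  simp_rw [ENNReal.ofReal_prod_of_nonneg fun i (_ : i ∈ T) => (noiseSum_pos t _ i (π i)).le]
  rw [lintegral_pi_prod_of_disjoint T (fun i => {i, π i} ×ˢ Finset.univ) (by
      intro i hi j hj hij
      have h1 := hdisj i hi j hj hij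
      have h2 := hdisj j hj i hi hij.symm
      simp [Function.onFun, Finset.disjoint_product, h1.1.symm, hij.symm, h2.1,
        h2.2])
    (fun i z => ENNReal.ofReal (noiseSum t z i (π i))) (fun j => by fun_prop) (by
      intro i _ z w hzw
      have h (k : ZMod L) : z (i, k) = w (i, k) := hzw _ (by simp)
      have h' (k : ZMod L) : z (π i, k) = w (π i, k) := hzw _ (by simp)
      simp [noiseSum, inner_shift_noiseSignal_noiseSignal, h, h'])]
  refine (Finset.prod_le_pow_card _ _ _ fun i hi => lintegral_noiseSum_le hL hv ht (hπ i hi)).trans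
    ?_
  have hL' : (2 : ℝ) ≤ L := by exact_mod_cast hL
  rw [← ENNReal.ofReal_pow (by positivity)]
  -- The crude bound `|T| ≤ N` suffices.
  refine ENNReal.ofReal_le_ofReal (pow_le_pow_right₀ (by linarith) ?_)
  simpa using Finset.card_le_univ T

end Noise

end MultirefAlign

namespace MultirefAlign

/-! ### Splitting the off-diagonal pairs into matchings. -/

section Matchings

variable {N : ℕ} [NeZero N]

/-- The two halves of the off-diagonal pairs `(i, c - i)`. -/
def antidiagonalHalf (p : Fin N × Bool) : Finset (Fin N) :=
  if p.2 then Finset.univ.filter fun i => i < p.1 - i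
  else Finset.univ.filter fun i => p.1 - i < i

omit [NeZero N] in
lemma ne_of_mem_antidiagonalHalf {p : Fin N × Bool} {i : Fin N} (hi : i ∈ antidiagonalHalf p) :
    i ≠ p.1 - i := by
  obtain ⟨c, _ | _⟩ := p
  · simp only [antidiagonalHalf, Bool.false_eq_true, if_false, Finset.mem_filter_univ] at hi
    exact hi.ne'
  · simp only [antidiagonalHalf, if_true, Finset.mem_filter_univ] at hi
    exact hi.ne

/-- The involution `i ↦ c - i` exchanges the two halves belonging to `c`, so a partner never lies in
the same half. -/
lemma antidiagonalHalf_disjoint {p : Fin N × Bool} {i j : Fin N} (hi : i ∈ antidiagonalHalf p)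
    (hj : j ∈ antidiagonalHalf p) (hij : i ≠ j) : i ≠ p.1 - j ∧ p.1 - i ≠ p.1 - j := by
  refine ⟨fun h => ?_, fun h => hij (sub_right_inj.1 h)⟩
  obtain ⟨c, _ | _⟩ := p
  · simp only [antidiagonalHalf, Bool.false_eq_true, if_false, Finset.mem_filter_univ] at hi hj h
    rw [h, sub_sub_cancel] at hi
    exact lt_asymm hi hj
  · simp only [antidiagonalHalf, if_true, Finset.mem_filter_univ] at hi hj h
    rw [h, sub_sub_cancel] at hi
    exact lt_asymm hi hj

/-- Pairs are sorted by `c = i + j` modulo `N` and then by which member is smaller; fixed points of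
`i ↦ c - i` are the diagonal pairs. -/
lemma sum_offDiag_eq_sum_antidiagonalHalf (f : Fin N → Fin N → ℝ) :
    ∑ i, ∑ j, (if i = j then 0 else f i j) =
      ∑ p : Fin N × Bool, ∑ i ∈ antidiagonalHalf p, f i (p.1 - i) := by
  have h (i : Fin N) : ∑ j, (if i = j then 0 else f i j) =
      ∑ c : Fin N, if i = c - i then 0 else f i (c - i) :=
    (Equiv.sum_comp (Equiv.subRight i) fun j => if i = j then 0 else f i j).symm
  simp_rw [h]
  rw [Finset.sum_comm, Fintype.sum_prod_type]
  refine Finset.sum_congr rfl fun c _ => ?_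
  simp only [Fintype.sum_bool, antidiagonalHalf, if_true, Bool.false_eq_true, if_false,
    Finset.sum_filter, ← Finset.sum_add_distrib]
  refine Finset.sum_congr rfl fun i _ => ?_
  rcases lt_trichotomy i (c - i) with h | h | h
  · simp [h, h.ne, h.not_gt]
  · simp [← h]
  · simp [h, h.ne', h.not_gt]

/-- Convexity of the exponential, applied to the decomposition of the off-diagonal pairs into
`2 N` families of disjoint pairs. -/
lemma exp_sum_log_offDiag_le {f : Fin N → Fin N → ℝ} (hf : ∀ i j, 0 < f i j) :
    Real.exp ((2 * N : ℝ)⁻¹ * ∑ i, ∑ j, if i = j then 0 else Real.log (f i j)) ≤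
      ∑ p : Fin N × Bool, (2 * N : ℝ)⁻¹ * ∏ i ∈ antidiagonalHalf p, f i (p.1 - i) := by
  have hN : (N : ℝ) ≠ 0 := by simp [NeZero.ne]
  rw [sum_offDiag_eq_sum_antidiagonalHalf, Finset.mul_sum]
  refine (convexOn_exp.map_sum_le (w := fun _ : Fin N × Bool => (2 * N : ℝ)⁻¹)
    (p := fun p => ∑ i ∈ antidiagonalHalf p, Real.log (f i (p.1 - i)))
    (fun _ _ => by positivity) ?_ fun _ _ => Set.mem_univ _).trans_eq ?_
  · simp
    field_simp
  · simp only [Real.exp_sum, Real.exp_log (hf _ _), smul_eq_mul]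

end Matchings

/-! ### Tail bounds for the two sums. -/

section Tail

variable {L : ℕ} [NeZero L] {N : ℕ}

-- This reduces to `c ≤ e² L²`, and the right side is at least `16`.
omit [NeZero L] in
lemma mul_exp_neg_three_log_le (hL : 2 ≤ L) {c : ℝ} (hc : c ≤ 6) :
    c * L * Real.exp (-(3 * Real.log (Real.exp 1 * L))) ≤ Real.exp (-1) := by
  have hL' : (2 : ℝ) ≤ L := by exact_mod_cast hL
  have he : 2 ≤ Real.exp 1 := by linarith [Real.add_one_le_exp (1 : ℝ)]
  have h3 : Real.exp (3 * Real.log (Real.exp 1 * L)) = (Real.exp 1 * L) ^ 3 := by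
    rw [show 3 * Real.log (Real.exp 1 * L) = ((3 : ℕ) : ℝ) * Real.log (Real.exp 1 * L) by norm_num,
      Real.exp_nat_mul, Real.exp_log (by positivity)]
  rw [Real.exp_neg, Real.exp_neg, h3, ← div_eq_mul_inv, div_le_iff₀ (by positivity),
    inv_mul_eq_div, le_div_iff₀ (by positivity)]
  have h1 : (4 : ℝ) ≤ Real.exp 1 ^ 2 := by nlinarith
  have h2 : (4 : ℝ) ≤ (L : ℝ) ^ 2 := by nlinarith
  have h4 : c ≤ Real.exp 1 ^ 2 * (L : ℝ) ^ 2 := by nlinarith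
  nlinarith [mul_le_mul_of_nonneg_right h4 (show 0 ≤ (L : ℝ) * Real.exp 1 by positivity)]

omit [NeZero L] in
lemma pow_mul_exp_neg_le (hL : 2 ≤ L) {c : ℝ} (hc0 : 0 ≤ c) (hc : c ≤ 6) (N : ℕ) :
    (c * L) ^ N * Real.exp (-(N * (3 * Real.log (Real.exp 1 * L)))) ≤ Real.exp (-N) := by
  rw [← mul_neg, Real.exp_nat_mul, ← mul_pow, show -(N : ℝ) = N * -1 by ring, Real.exp_nat_mul]
  exact pow_le_pow_left₀ (by positivity) (mul_exp_neg_three_log_le hL hc) N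

lemma measure_crossSum_le (hL : 2 ≤ L) {v : ℝ≥0} (x : Signal L) {t : ℝ}
    (ht : v * (t ^ 2 * ‖x‖ ^ 2) ≤ 1) :
    noiseLaw N L v {z | N * (3 * Real.log (Real.exp 1 * L)) ≤
      ∑ j, Real.log (crossSum x t z j)} ≤ ENNReal.ofReal (Real.exp (-N)) := by
  refine (measure_ge_le_ofReal_mul_exp_neg (A := (2 * L * Real.exp (1 / 2)) ^ N) ?_ ?_ _).trans
    (ENNReal.ofReal_le_ofReal ?_)
  · fun_prop
  · simp_rw [Real.exp_sum, Real.exp_log (crossSum_pos x t _ _)]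
    exact lintegral_prod_crossSum_le x ht
  · rw [show 2 * L * Real.exp (1 / 2) = 2 * Real.exp (1 / 2) * L by ring]
    refine pow_mul_exp_neg_le hL (by positivity) ?_ N
    have h1 : Real.exp (1 / 2) ≤ Real.exp 1 := Real.exp_le_exp.2 (by norm_num)
    linarith [Real.exp_one_lt_d9]

lemma measure_noiseSum_le [NeZero N] (hL : 2 ≤ L) {v : ℝ≥0} (hv : v ≠ 0) {t : ℝ}
    (ht : (v : ℝ) ^ 2 * t ^ 2 = (L : ℝ)⁻¹) :
    noiseLaw N L v {z | (N : ℝ) ^ 2 * (6 * Real.log (Real.exp 1 * L)) ≤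
      ∑ i, ∑ j, if i = j then 0 else Real.log (noiseSum t z i j)} ≤
        ENNReal.ofReal (Real.exp (-N)) := by
  have hN : (0 : ℝ) < N := by exact_mod_cast Nat.pos_of_ne_zero (NeZero.ne N)
  -- Division by `2 N` matches the weights in the convexity bound.
  have hset : {z : Fin N × ZMod L → ℝ | (N : ℝ) ^ 2 * (6 * Real.log (Real.exp 1 * L)) ≤
      ∑ i, ∑ j, if i = j then 0 else Real.log (noiseSum t z i j)} =
      {z | N * (3 * Real.log (Real.exp 1 * L)) ≤
        (2 * N : ℝ)⁻¹ * ∑ i, ∑ j, if i = j then 0 else Real.log (noiseSum t z i j)} := by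
    ext z
    rw [Set.mem_ofPred_eq, Set.mem_ofPred_eq, le_inv_mul_iff₀ (by positivity)]
    refine Eq.to_iff (congrArg (· ≤ _) ?_)
    ring
  rw [hset]
  refine (measure_ge_le_ofReal_mul_exp_neg (A := (6 * L) ^ N) ?_ ?_ _).trans
    (ENNReal.ofReal_le_ofReal (pow_mul_exp_neg_le hL (by norm_num) le_rfl N))
  · refine .const_mul (Finset.measurable_sum _ fun i _ => Finset.measurable_sum _ fun j _ => ?_) _
    split_ifs <;> fun_prop
  · have hprod (z) (p : Fin N × Bool) :
        0 ≤ ∏ i ∈ antidiagonalHalf p, noiseSum (L := L) t z i (p.1 - i) :=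
      Finset.prod_nonneg fun i _ => (noiseSum_pos _ _ _ _).le
    calc _ ≤ ∫⁻ z, ENNReal.ofReal (∑ p : Fin N × Bool, (2 * N : ℝ)⁻¹ *
            ∏ i ∈ antidiagonalHalf p, noiseSum t z i (p.1 - i)) ∂noiseLaw N L v :=
          lintegral_mono fun z => ENNReal.ofReal_le_ofReal
            (exp_sum_log_offDiag_le fun i j => noiseSum_pos t z i j)
      _ = ∑ p : Fin N × Bool, ENNReal.ofReal (2 * N : ℝ)⁻¹ * ∫⁻ z, ENNReal.ofReal
            (∏ i ∈ antidiagonalHalf p, noiseSum t z i (p.1 - i)) ∂noiseLaw N L v := by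
          simp_rw [ENNReal.ofReal_sum_of_nonneg fun p (_ : p ∈ Finset.univ) =>
            mul_nonneg (inv_nonneg.2 (by positivity : (0 : ℝ) ≤ 2 * N)) (hprod _ p),
            ENNReal.ofReal_mul (inv_nonneg.2 (by positivity : (0 : ℝ) ≤ 2 * N))]
          rw [lintegral_finsetSum _ fun p _ => by fun_prop]
          refine Finset.sum_congr rfl fun p _ => lintegral_const_mul _ (by fun_prop)
      _ ≤ ∑ p : Fin N × Bool, ENNReal.ofReal (2 * N : ℝ)⁻¹ * ENNReal.ofReal ((6 * L) ^ N) := by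
          gcongr with p
          exact lintegral_prod_noiseSum_le hL hv ht _ _ (fun i hi => ne_of_mem_antidiagonalHalf hi)
            fun i hi j hj hij => antidiagonalHalf_disjoint hi hj hij
      _ = _ := by
          rw [Finset.sum_const, Finset.card_univ, nsmul_eq_mul, ← ENNReal.ofReal_natCast,
            ← ENNReal.ofReal_mul (by positivity), ← ENNReal.ofReal_mul (by positivity)]
          congr 1
          simp
          field_simp

end Tail

/-! ### Assembly. -/

section Assembly

variable {L : ℕ} [NeZero L] {N : ℕ}

lemma sum_deviation_le_of_sum_log_le {x : Signal L} (hΔ : 0 < shiftGap x) {σ : ℝ≥0} (hσ : σ ≠ 0)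
    {ℓ : Fin N → ZMod L} {z : Fin N × ZMod L → ℝ}
    (h1 : ∑ j, Real.log (crossSum x (σ * ‖x‖)⁻¹ z j) ≤ N * (3 * Real.log (Real.exp 1 * L)))
    (h2 : (∑ i, ∑ j, if i = j then 0 else Real.log (noiseSum ((σ : ℝ) ^ 2 * √L)⁻¹ z i j)) ≤
      (N : ℝ) ^ 2 * (6 * Real.log (Real.exp 1 * L)))
    {V : BlockMatrix N L} (hV : IsSDPSolution (observation x ℓ (noiseSignal z)) V) :
    ∑ i, ∑ j, deviation ℓ V i j ≤
      12 * Real.log (Real.exp 1 * L) * (σ * (‖x‖ + σ * √L)) / shiftGap x * (N : ℝ) ^ 2 := by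
  have hx := norm_pos_of_shiftGap_pos hΔ
  have hσ' : (0 : ℝ) < σ := by positivity
  have hL : (0 : ℝ) < L := by exact_mod_cast Nat.pos_of_ne_zero (NeZero.ne L)
  have hs : 0 < (σ : ℝ) * ‖x‖ := by positivity
  have ht : 0 < (σ : ℝ) ^ 2 * √L := by positivity
  have h := hV.shiftGap_mul_sum_deviation_le
    (b := fun j => σ * ‖x‖ * Real.log (crossSum x (σ * ‖x‖)⁻¹ z j))
    (a := fun i j => (σ : ℝ) ^ 2 * √L * Real.log (noiseSum ((σ : ℝ) ^ 2 * √L)⁻¹ z i j))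
    (fun j m => by
      have := abs_le_log_coshSum
        (fun m => ((σ : ℝ) * ‖x‖)⁻¹ * inner ℝ (shift m x) (noiseSignal z j)) m
      rw [abs_mul, abs_of_pos (inv_pos.2 hs), inv_mul_le_iff₀ hs] at this
      exact this)
    (fun i j m => by
      have := abs_le_log_coshSum
        (fun m => ((σ : ℝ) ^ 2 * √L)⁻¹ * inner ℝ (shift m (noiseSignal z i)) (noiseSignal z j)) m
      rw [abs_mul, abs_of_pos (inv_pos.2 ht), inv_mul_le_iff₀ ht] at this
      exact this)
  have h3 : (∑ i, ∑ j, if i = j then 0 else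
      (σ : ℝ) ^ 2 * √L * Real.log (noiseSum ((σ : ℝ) ^ 2 * √L)⁻¹ z i j)) =
      (σ : ℝ) ^ 2 * √L * ∑ i, ∑ j, if i = j then 0 else
        Real.log (noiseSum ((σ : ℝ) ^ 2 * √L)⁻¹ z i j) := by
    simp only [Finset.mul_sum, mul_ite, mul_zero]
  rw [h3, ← Finset.mul_sum] at h
  rw [div_mul_eq_mul_div, le_div_iff₀ hΔ, mul_comm]
  -- Both terms produce the constant: `12 = 4 * 3 = 2 * 6`.
  have h1' := mul_le_mul_of_nonneg_left h1 (show 0 ≤ 4 * N * ((σ : ℝ) * ‖x‖) by positivity)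
  have h2' := mul_le_mul_of_nonneg_left h2 ht.le
  linarith

end Assembly

end MultirefAlign

theorem mainTheorem3 :
    ∃ r : ℕ → ℝ, r =o[atTop] (fun N : ℕ => (N : ℝ)) ∧
      ∀ (L : ℕ) [NeZero L] (_hL : 2 ≤ L) (x : MultirefAlign.Signal L)
        (_hΔ : 0 < MultirefAlign.shiftGap x) (σ : ℝ≥0) (N : ℕ) (ℓ : Fin N → ZMod L)
        {Ω : Type*} [MeasurableSpace Ω] (P : Measure Ω) [IsProbabilityMeasure P]
        (ξ : Fin N → Ω → MultirefAlign.Signal L) (_hξ : MultirefAlign.IsWhiteNoise P σ ξ),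
        P {ω | (∃ V, MultirefAlign.IsSDPSolution
                  (MultirefAlign.observation x ℓ fun i => ξ i ω) V) ∧
              ∀ V, MultirefAlign.IsSDPSolution
                  (MultirefAlign.observation x ℓ fun i => ξ i ω) V →
                ∑ i, ∑ j, MultirefAlign.deviation ℓ V i j ≤
                  12 * Real.log (Real.exp 1 * L) * ((σ : ℝ) * (‖x‖ + σ * Real.sqrt L)) /
                    MultirefAlign.shiftGap x * (N : ℝ) ^ 2}ᶜ
          ≤ ENNReal.ofReal (Real.exp (-(N : ℝ) + r N)) := by
  -- The term `log 2` pays for the union of two bad events.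
  refine ⟨fun _ => Real.log 2, isLittleO_const_left.2 <| .inr <|
    tendsto_norm_atTop_atTop.comp tendsto_natCast_atTop_atTop, ?_⟩
  intro L _ hL x hΔ σ N ℓ Ω _ P _ ξ hξ
  rw [Real.exp_add, Real.exp_log two_pos]
  rcases eq_or_ne N 0 with rfl | hN
  · refine prob_le_one.trans ?_
    simp
  have : NeZero N := ⟨hN⟩
  -- The scalings `(σ ‖x‖)⁻¹` and `(σ² √L)⁻¹` need `σ ≠ 0`; for `σ = 0` the noise vanishes almost
  -- surely and `a = b = 0` works.
  rcases eq_or_ne σ 0 with rfl | hσ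
  · have h0 : ∀ᵐ ω ∂P, ∀ i k, ξ i ω k = 0 := by
      refine ae_all_iff.2 fun i => ae_all_iff.2 fun k => HasLaw.ae_eq_of_dirac ?_
      simpa using hξ.law i k
    refine (le_of_eq ?_).trans zero_le
    refine mem_ae_iff.1 ?_
    filter_upwards [h0] with ω hω
    refine ⟨MultirefAlign.exists_isSDPSolution _, fun V hV => ?_⟩
    have hz (i : Fin N) : ξ i ω = 0 := by
      ext k
      exact hω i k
    have h := hV.shiftGap_mul_sum_deviation_le (b := 0) (a := 0) (by simp [hz]) (by simp [hz])
    simp only [Pi.zero_apply, Finset.sum_const_zero, ite_self, mul_zero, add_zero] at h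
    simpa using nonpos_of_mul_nonpos_right h hΔ
  have hx := MultirefAlign.norm_pos_of_shiftGap_pos hΔ
  have hσ' : (0 : ℝ) < σ := by positivity
  have hL' : (0 : ℝ) < L := by exact_mod_cast Nat.pos_of_ne_zero (NeZero.ne L)
  let X (ω : Ω) (p : Fin N × ZMod L) : ℝ := ξ p.1 ω p.2
  have hX : HasLaw X (MultirefAlign.noiseLaw N L (σ ^ 2)) P :=
    iIndepFun.hasLaw_pi (fun p => hξ.law p.1 p.2) hξ.indep
  set B₁ : Set (Fin N × ZMod L → ℝ) := {z | N * (3 * Real.log (Real.exp 1 * L)) ≤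
    ∑ j, Real.log (MultirefAlign.crossSum x (σ * ‖x‖)⁻¹ z j)} with hB₁
  set B₂ : Set (Fin N × ZMod L → ℝ) := {z | (N : ℝ) ^ 2 * (6 * Real.log (Real.exp 1 * L)) ≤
    ∑ i, ∑ j, if i = j then 0 else
      Real.log (MultirefAlign.noiseSum ((σ : ℝ) ^ 2 * √L)⁻¹ z i j)} with hB₂
  have hP₁ : MultirefAlign.noiseLaw N L (σ ^ 2) B₁ ≤ ENNReal.ofReal (Real.exp (-N)) := by
    refine MultirefAlign.measure_crossSum_le hL x (le_of_eq ?_)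
    push_cast
    field_simp
  have hP₂ : MultirefAlign.noiseLaw N L (σ ^ 2) B₂ ≤ ENNReal.ofReal (Real.exp (-N)) := by
    refine MultirefAlign.measure_noiseSum_le hL (pow_ne_zero 2 hσ) ?_
    push_cast
    rw [inv_pow, mul_pow, Real.sq_sqrt hL'.le]
    field_simp
  calc _ ≤ P (X ⁻¹' (B₁ ∪ B₂)) := by
        refine measure_mono fun ω hω => ?_
        by_contra hgood
        simp only [Set.mem_preimage, Set.mem_union, not_or, hB₁, hB₂, Set.mem_ofPred_eq,
          not_le] at hgood
        exact hω ⟨MultirefAlign.exists_isSDPSolution _, fun V hV =>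
          MultirefAlign.sum_deviation_le_of_sum_log_le hΔ hσ hgood.1.le hgood.2.le hV⟩
    -- This inequality needs no measurability of the bad set.
    _ ≤ P.map X (B₁ ∪ B₂) := Measure.le_map_apply hX.aemeasurable _
    _ = MultirefAlign.noiseLaw N L (σ ^ 2) (B₁ ∪ B₂) := by rw [hX.map_eq]
    _ ≤ ENNReal.ofReal (Real.exp (-N)) + ENNReal.ofReal (Real.exp (-N)) :=
        (measure_union_le _ _).trans (add_le_add hP₁ hP₂)
    _ = _ := by
        rw [← ENNReal.ofReal_add (Real.exp_pos _).le (Real.exp_pos _).le]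
        congr 1
        ring
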